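/- For $n\ge 2$ let $\mathbb{S}^n$ be the space of real symmetric $n\times n$ matrices, let $\mathbb{L}^n=\{x\in\mathbb{R}^n \mid x_1\ge\sqrt{x_2^2+\cdots+x_n^2}\}$ be the second-order cone, and let $$\mathcal{COP}(\mathbb{L}^n)=\{A\in\mathbb{S}^n \mid x^\top A x\ge 0 \text{ for all } x\in\mathbb{L}^n\}$$ be the copositive cone over $\mathbb{L}^n$. A face of a closed convex cone $\mathbb{K}$ is a nonempty convex subcone $\mathbb{F}\subseteq\mathbb{K}$ such that $a,b\in\mathbb{K}$ and $a+b\in\mathbb{F}$ imply $a,b\in\mathbb{F}$. A cone is polyhedral if it is the intersection of finitely many closed half-spaces $\{x\mid \varphi(x)\ge 0\}$ with $\varphi$ a linear functional. The distance to polyhedrality $\ell_{\rm poly}(\mathbb{K})$ of $\mathbb{K}$ is the maximum length $l$ of a chain $\mathbb{F}_l\subsetneq\cdots\subsetneq\mathbb{F}_1$ of faces of $\mathbb{K}$ whose smallest member $\mathbb{F}_l$ is not polyhedral. Then $$\ell_{\rm poly}(\mathcal{COP}(\mathbb{L}^n))=\begin{cases}1 & (n=2),\\ n & (n\ge 3).\end{cases}$$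 -/

import Mathlib

open scoped Matrix

noncomputable section

namespace CopositiveSOC

/-- The space `𝕊ⁿ` of real symmetric `n × n` matrices. -/
def Sym (n : ℕ) : Submodule ℝ (Matrix (Fin n) (Fin n) ℝ) where
  carrier := {A | A.IsSymm}
  zero_mem' := Matrix.isSymm_zero
  add_mem' := fun hA hB => Matrix.IsSymm.add hA hB
  smul_mem' := fun c _ hA => Matrix.IsSymm.smul hA c

/-- The second-order cone `𝕃ⁿ = {x ∈ ℝⁿ | x₁ ≥ √(x₂² + ⋯ + xₙ²)}`; the first coordinate has
index `0`. -/
def secondOrderCone (n : ℕ) [NeZero n] : Set (Fin n → ℝ) :=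
  {x | √(∑ i ∈ Finset.univ.erase (0 : Fin n), x i ^ 2) ≤ x 0}

/-- The copositive cone `COP(K) = {A ∈ 𝕊ⁿ | xᵀ A x ≥ 0 for all x ∈ K}`. -/
def COP {n : ℕ} (K : Set (Fin n → ℝ)) : PointedCone ℝ (Sym n) where
  carrier := {A | ∀ x ∈ K, 0 ≤ x ⬝ᵥ ((A : Matrix (Fin n) (Fin n) ℝ) *ᵥ x)}
  zero_mem' := by
    intro x _
    simp
  add_mem' := by
    intro A B hA hB x hx
    have h := add_nonneg (hA x hx) (hB x hx)
    simpa [Matrix.add_mulVec, dotProduct_add] using h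
  smul_mem' := by
    intro c A hA x hx
    have h := mul_nonneg c.2 (hA x hx)
    have e : ((c • A : Sym n) : Matrix (Fin n) (Fin n) ℝ)
        = (c : ℝ) • (A : Matrix (Fin n) (Fin n) ℝ) := rfl
    rw [e, Matrix.smul_mulVec, dotProduct_smul]
    exact h

variable {E : Type*} [AddCommGroup E] [Module ℝ E]

/-- A cone in a finite-dimensional real vector space is polyhedral if it is the intersection of
finitely many half-spaces `{x | 0 ≤ φ x}`, with `φ` a linear functional. -/
def IsPolyhedral (C : PointedCone ℝ E) : Prop :=
  C.DualFG (LinearMap.id : Module.Dual ℝ E →ₗ[ℝ] Module.Dual ℝ E)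

/-- `F 0 ⊋ F 1 ⊋ ⋯ ⊋ F k` is a chain of faces of `C` (of length `k + 1`) whose smallest member
`F k` is not polyhedral. -/
structure IsNonpolyhedralChain (C : PointedCone ℝ E) {k : ℕ}
    (F : Fin (k + 1) → PointedCone ℝ E) : Prop where
  strictAnti : StrictAnti F
  isFaceOf : ∀ i, (F i).IsFaceOf C
  not_isPolyhedral : ¬ IsPolyhedral (F (Fin.last k))

/-- The distance to polyhedrality of `C`: the maximum length (number of faces) of a chain of faces
of `C` whose smallest member is not polyhedral. It is `0` if there is no such chain and `⊤` if
their lengths are unbounded; any other value is attained, being a finite supremum of natural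
numbers. -/
def distToPolyhedrality (C : PointedCone ℝ E) : ℕ∞ :=
  sSup {l : ℕ∞ | ∃ (k : ℕ) (F : Fin (k + 1) → PointedCone ℝ E),
    IsNonpolyhedralChain C F ∧ l = (k : ℕ∞) + 1}

end CopositiveSOC

end

/-!
Let `J = diag(1, -1, …, -1)`. Since `x ∈ 𝕃ⁿ` or `-x ∈ 𝕃ⁿ` exactly when `xᵀ J x ≥ 0`, the S-lemma
shows that `COP(𝕃ⁿ)` is generated by `J` and the matrices `v vᵀ`, and so is every face, by those
generators that lie in it.

Upper bound: for a face `F` the vectors `v` with `v vᵀ ∈ F` form a subspace `V`. The rank of `F`,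
which is `dim V` plus one if `J ∈ F`, is strictly monotone on faces and at most `n + 1`. If
`dim V ≤ 1`, then `F` has at most two extreme rays and is polyhedral; hence the ranks of a
nonpolyhedral chain lie in `{2, …, n + 1}`. For `n = 2` they are all `3`, since `V = ℝⁿ` forces
`J ∈ F`: the identity is the sum of `J` and a positive semidefinite matrix.

Lower bound: for a null vector `u` of `J` in `𝕃ⁿ`, the matrices of `COP(𝕃ⁿ)` whose quadratic form
vanishes at `u` form a face, and the positive semidefinite ones among them a face of that face.
Below it lie the faces of positive semidefinite matrices vanishing on a subspace `W ∋ u`, which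
are not polyhedral as long as `dim W ≤ n - 2`.
-/

noncomputable section

namespace CopositiveSOC

section Faces

variable {E : Type*} [AddCommGroup E] [Module ℝ E] {C F : PointedCone ℝ E}

theorem hull_inter_eq_of_isFaceOf {S : Set E} (hF : F.IsFaceOf (PointedCone.hull ℝ S)) :
    PointedCone.hull ℝ (S ∩ F) = F := by
  refine le_antisymm (Submodule.span_le.2 Set.inter_subset_right) fun x hx => ?_
  obtain ⟨c, hcS, hc, rfl⟩ := PointedCone.mem_hull_set.1 (hF.le hx)
  rw [Finsupp.sum, ← Finset.sum_coe_sort] at hx ⊢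
  refine Submodule.sum_mem _ fun y _ => PointedCone.smul_mem _ (hc y)
    (PointedCone.subset_hull ⟨hcS y.2, ?_⟩)
  exact hF.mem_of_sum_smul_mem (fun z : c.support => PointedCone.subset_hull (hcS z.2))
    (fun z => hc z) hx y ((hc y).lt_of_ne' (Finsupp.mem_support_iff.1 y.2))

theorem isFaceOf_inf_ker {φ : E →ₗ[ℝ] ℝ} (hφ : ∀ x ∈ C, 0 ≤ φ x) :
    (C ⊓ PointedCone.ofSubmodule φ.ker).IsFaceOf C := by
  refine .of_mem_of_add_mem_left inf_le_left fun {x y} hx hy hxy => ⟨hx, ?_⟩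
  have hsum : φ x + φ y = 0 := by simpa using hxy.2
  exact le_antisymm (by linarith [hφ y hy]) (hφ x hx)

end Faces

section Polyhedral

variable {E : Type*} [AddCommGroup E] [Module ℝ E] {C : PointedCone ℝ E}

theorem isPolyhedral_hull_of_linearIndepOn [FiniteDimensional ℝ E] {S : Set E}
    (hS : LinearIndepOn ℝ id S) : IsPolyhedral (PointedCone.hull ℝ S) := by
  let b := Module.Basis.extend hS
  have hb (i) : b i = i := Module.Basis.extend_apply_self hS i
  have : Finite (hS.extend (Set.subset_univ S)) := Module.Finite.finite_basis b
  have := Fintype.ofFinite (hS.extend (Set.subset_univ S))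
  let Φ : Set (Module.Dual ℝ E) := Set.range b.coord ∪ (fun i => -b.coord i) '' {i | ↑i ∉ S}
  have hΦ : Φ.Finite := (Set.finite_range _).union (Set.toFinite _)
  suffices h : PointedCone.hull ℝ S = PointedCone.dual LinearMap.id Φ from
    h ▸ PointedCone.DualFG.dual_of_finite _ hΦ
  apply le_antisymm
  · refine Submodule.span_le.2 fun x hx => ?_
    obtain ⟨k, rfl⟩ : ∃ k, b k = x := ⟨⟨x, hS.subset_extend _ hx⟩, hb _⟩
    rintro _ (⟨i, rfl⟩ | ⟨i, hi, rfl⟩)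
    · simp only [LinearMap.id_apply, b.coord_apply, b.repr_self]
      exact Finsupp.single_nonneg.2 zero_le_one i
    · have hki : k ≠ i := fun h => hi (hb i ▸ h ▸ hx)
      simp [hki]
  · intro x hx
    rw [← b.sum_repr x]
    refine Submodule.sum_mem _ fun i _ => ?_
    have hi : 0 ≤ b.repr x i := hx (Or.inl ⟨i, rfl⟩)
    by_cases hiS : ↑i ∈ S
    · exact PointedCone.smul_mem _ hi (PointedCone.subset_hull (by rwa [hb]))
    · have hi' : 0 ≤ -b.repr x i := hx (Or.inr ⟨i, hiS, rfl⟩)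
      rw [le_antisymm (neg_nonneg.1 hi') hi, zero_smul]
      exact Submodule.zero_mem _

open Filter Topology in
theorem exists_apply_eq_zero_of_sub_smul_notMem {Φ : Finset (Module.Dual ℝ E)} {x r : E}
    (hx : x ∈ PointedCone.dual LinearMap.id (Φ : Set (Module.Dual ℝ E)))
    (hxr : ∀ ε > (0 : ℝ), x - ε • r ∉ PointedCone.dual LinearMap.id (Φ : Set (Module.Dual ℝ E))) :
    ∃ φ ∈ Φ, φ x = 0 ∧ φ r ≠ 0 := by
  by_contra! h
  have hnear : ∀ φ ∈ Φ, ∀ᶠ ε : ℝ in 𝓝[>] 0, 0 ≤ φ (x - ε • r) := by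
    intro φ hφ
    rcases (show 0 ≤ φ x from hx hφ).eq_or_lt with hφx | hφx
    · simp [← hφx, h φ hφ hφx.symm]
    · have hcont : Tendsto (fun ε : ℝ => φ (x - ε • r)) (𝓝[>] 0) (𝓝 (φ x)) := by
        simp only [map_sub, map_smul, smul_eq_mul]
        exact (Continuous.tendsto' (by fun_prop) _ _ (by simp)).mono_left nhdsWithin_le_nhds
      exact (hcont.eventually_const_lt hφx).mono fun _ => le_of_lt
  obtain ⟨ε, hε, hε0⟩ :=
    (((eventually_all_finset Φ).2 hnear).and self_mem_nhdsWithin).exists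
  exact hxr ε hε0 fun φ hφ => hε φ hφ

open Polynomial in
theorem finite_setOf_quadratic_eq_zero (a b : ℝ) {c : ℝ} (hc : c ≠ 0) :
    {s : ℝ | a + s * b + s ^ 2 * c = 0}.Finite := by
  have hP : C c * X ^ 2 + C b * X + C a ≠ 0 := fun h => by
    simpa [h] using natDegree_quadratic (b := b) (c := a) hc
  refine (finite_setOfPred_isRoot hP).subset fun s hs => ?_
  simp only [Set.mem_ofPred_eq, IsRoot, eval_add, eval_mul, eval_C, eval_pow, eval_X] at hs ⊢
  linarith

/-- Each half-space meets its boundary in at most two points of the parabola, so finitely many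
half-spaces cannot keep infinitely many of its points on the boundary. -/
theorem not_isPolyhedral_of_parabola {p q r : E} {S : Set ℝ} (hS : S.Infinite)
    (hmem : ∀ s ∈ S, p + s • q + s ^ 2 • r ∈ C)
    (hnot : ∀ s ∈ S, ∀ ε > (0 : ℝ), p + s • q + s ^ 2 • r - ε • r ∉ C) : ¬ IsPolyhedral C := by
  rintro ⟨Φ, rfl⟩
  refine hS ((Φ.finite_toSet.biUnion fun φ _ =>
    show {s : ℝ | φ p + s * φ q + s ^ 2 * φ r = 0 ∧ φ r ≠ 0}.Finite from ?_).subset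
      fun s hs => ?_)
  · by_cases hr : φ r = 0
    · simp [hr]
    · exact (finite_setOf_quadratic_eq_zero _ _ hr).subset fun s => And.left
  · obtain ⟨φ, hφ, hzero, hr⟩ :=
      exists_apply_eq_zero_of_sub_smul_notMem (hmem s hs) (hnot s hs)
    exact Set.mem_biUnion hφ ⟨by simpa using hzero, hr⟩

end Polyhedral

section Chains

variable {E : Type*} [AddCommGroup E] [Module ℝ E] {C F : PointedCone ℝ E}

theorem one_le_distToPolyhedrality (hC : ¬ IsPolyhedral C) : 1 ≤ distToPolyhedrality C :=
  le_sSup ⟨0, fun _ => C, ⟨fun i j hij => by omega, fun _ => .rfl, hC⟩, by simp⟩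

theorem distToPolyhedrality_add_one_le (hF : F.IsFaceOf C) (hne : F ≠ C)
    (hpos : 1 ≤ distToPolyhedrality F) : distToPolyhedrality F + 1 ≤ distToPolyhedrality C := by
  have hchain : {l : ℕ∞ | ∃ (k : ℕ) (G : Fin (k + 1) → PointedCone ℝ E),
      IsNonpolyhedralChain F G ∧ l = k + 1}.Nonempty := by
    by_contra! h
    rw [distToPolyhedrality, h, sSup_empty] at hpos
    exact absurd hpos (by simp)
  rw [distToPolyhedrality, ENat.sSup_add hchain]
  refine iSup₂_le ?_
  rintro _ ⟨k, G, hG, rfl⟩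
  refine le_sSup ⟨k + 1, Fin.cons C G, ⟨?_, ?_, ?_⟩, by push_cast; rfl⟩
  · rw [Fin.strictAnti_iff_succ_lt]
    exact Fin.cases ((hG.isFaceOf 0).le.trans_lt (hF.le.lt_of_ne hne))
      fun i => hG.strictAnti i.castSucc_lt_succ
  · exact Fin.cases .rfl fun i => (hG.isFaceOf i).trans hF
  · simpa [← Fin.succ_last] using hG.not_isPolyhedral

theorem distToPolyhedrality_le_of_strictMonoOn {rank : PointedCone ℝ E → ℕ} {a b : ℕ}
    (hmono : StrictMonoOn rank {F | F.IsFaceOf C}) (hle : ∀ F, F.IsFaceOf C → rank F ≤ b)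
    (hge : ∀ F, F.IsFaceOf C → ¬ IsPolyhedral F → a ≤ rank F) :
    distToPolyhedrality C ≤ (b + 1 - a : ℕ) := by
  refine sSup_le ?_
  rintro _ ⟨k, F, hF, rfl⟩
  have hrank : ∀ i, rank (F i) + i ≤ b := by
    intro i
    induction i using Fin.induction with
    | zero => exact hle _ (hF.isFaceOf 0)
    | succ i ih =>
      have hlt := hmono (hF.isFaceOf _) (hF.isFaceOf _) (hF.strictAnti i.castSucc_lt_succ)
      simp only [Fin.val_castSucc, Fin.val_succ] at ih ⊢
      omega
  have hlast : rank (F (Fin.last k)) + k ≤ b := hrank (Fin.last k)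
  have hlast_ge := hge _ (hF.isFaceOf _) hF.not_isPolyhedral
  exact_mod_cast (by omega : k + 1 ≤ b + 1 - a)

end Chains

section SLemma

variable {M : Type*} [AddCommGroup M] [Module ℝ M] {A B : QuadraticForm ℝ M}

theorem exists_roots_of_pos_of_neg (b : ℝ) {p q : ℝ} (hp : 0 < p) (hq : q < 0) :
    ∃ s > 0, ∃ t < 0, p * s ^ 2 + b * s + q = 0 ∧ p * t ^ 2 + b * t + q = 0 ∧ p * s * t = q := by
  obtain ⟨r, hbr, hr⟩ : ∃ r, |b| < r ∧ r ^ 2 = b ^ 2 - 4 * p * q := by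
    have hlt : b ^ 2 < b ^ 2 - 4 * p * q := by nlinarith
    exact ⟨√(b ^ 2 - 4 * p * q), Real.lt_sqrt_of_sq_lt (by rwa [sq_abs]),
      Real.sq_sqrt ((sq_nonneg b).trans hlt.le)⟩
  obtain ⟨s, hs_def⟩ : ∃ s, 2 * p * s = r - b := ⟨(r - b) / (2 * p), by field_simp⟩
  have hs : 0 < s := by
    refine pos_of_mul_pos_right (?_ : 0 < 2 * p * s) (by positivity)
    linarith [le_abs_self b]
  have hroot : p * s ^ 2 + b * s + q = 0 := by
    refine (mul_eq_zero.1 (?_ : 4 * p * _ = 0)).resolve_left (by positivity)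
    linear_combination (2 * p * s + r + b) * hs_def + hr
  have hprod : p * s * (q / (p * s)) = q := mul_div_cancel₀ _ (by positivity)
  refine ⟨s, hs, q / (p * s), div_neg_of_neg_of_pos hq (by positivity), hroot, ?_, hprod⟩
  generalize q / (p * s) = t at hprod
  have hsum : p * s + b + p * t = 0 := by
    refine (mul_eq_zero.1 (?_ : s * _ = 0)).resolve_left hs.ne'
    linear_combination hroot + hprod
  linear_combination t * hsum - hprod

theorem quadraticForm_smul_add (Q : QuadraticForm ℝ M) (s : ℝ) (x y : M) :
    Q (s • x + y) = Q x * s ^ 2 + QuadraticMap.polar Q x y * s + Q y := by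
  rw [QuadraticMap.map_add Q, QuadraticMap.map_smul, QuadraticMap.polar_smul_left]
  simp only [smul_eq_mul]
  ring

/-- The line through `y` in the direction `x` meets `{B = 0}` in two points, where `A` is
nonnegative; the combination that eliminates the cross term gives the claim. -/
theorem mul_le_mul_of_nonneg_imp (h : ∀ x, 0 ≤ B x → 0 ≤ A x) {x y : M} (hx : 0 < B x)
    (hy : B y < 0) : B y * A x ≤ B x * A y := by
  obtain ⟨s, hs, t, ht, hBs, hBt, hst⟩ :=
    exists_roots_of_pos_of_neg (QuadraticMap.polar B x y) hx hy
  have hAs := h (s • x + y) (by rw [quadraticForm_smul_add, hBs])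
  have hAt := h (t • x + y) (by rw [quadraticForm_smul_add, hBt])
  rw [quadraticForm_smul_add] at hAs hAt
  have helim : 0 ≤ (s - t) * (A y - s * t * A x) := by
    linarith [mul_nonneg hs.le hAt, mul_nonneg (neg_nonneg.2 ht.le) hAs]
  have hle : s * t * A x ≤ A y :=
    sub_nonneg.1 (nonneg_of_mul_nonneg_right helim (by linarith))
  calc B y * A x = B x * (s * t * A x) := by rw [← hst]; ring
    _ ≤ B x * A y := mul_le_mul_of_nonneg_left hle hx.le

theorem exists_mul_le_of_nonneg_imp (h : ∀ x, 0 ≤ B x → 0 ≤ A x) (hB : ∃ x, 0 < B x) :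
    ∃ t ≥ 0, ∀ x, t * B x ≤ A x := by
  obtain ⟨x₀, hx₀⟩ := hB
  obtain ⟨t, hlower, hupper⟩ := exists_between_of_forall_le
    (s := insert 0 ((fun y => A y / B y) '' {y | B y < 0}))
    (t := (fun x => A x / B x) '' {x | 0 < B x})
    (Set.insert_nonempty _ _) ⟨_, x₀, hx₀, rfl⟩ <| by
      rintro _ (rfl | ⟨y, hy, rfl⟩) _ ⟨x, hx, rfl⟩
      · exact div_nonneg (h x (le_of_lt hx)) (le_of_lt hx)
      · have := mul_le_mul_of_nonneg_imp h hx hy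
        rw [div_le_iff_of_neg hy, div_mul_eq_mul_div, div_le_iff₀ hx]
        linarith
  refine ⟨t, hlower (Set.mem_insert 0 _), fun x => ?_⟩
  rcases lt_trichotomy (B x) 0 with hx | hx | hx
  · exact (div_le_iff_of_neg hx).1 (hlower (Set.mem_insert_of_mem _ ⟨x, hx, rfl⟩))
  · rw [hx, mul_zero]
    exact h x hx.ge
  · exact (le_div_iff₀ hx).1 (hupper ⟨x, hx, rfl⟩)

end SLemma

section QuadForm

variable {n : ℕ} {A : Sym n} {K : Set (Fin n → ℝ)}

/-- The symmetric bilinear form `(x, y) ↦ xᵀ A y`, linear in `A`. -/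
def bilinForm : Sym n →ₗ[ℝ] LinearMap.BilinForm ℝ (Fin n → ℝ) :=
  (Matrix.toLinearMap₂' ℝ).toLinearMap ∘ₗ (Sym n).subtype

/-- The quadratic form `x ↦ xᵀ A x`, linear in `A`. -/
def quadForm : Sym n →ₗ[ℝ] QuadraticForm ℝ (Fin n → ℝ) :=
  LinearMap.BilinMap.toQuadraticMapLinearMap ℝ ℝ (Fin n → ℝ) ∘ₗ bilinForm

theorem bilinForm_apply (A : Sym n) (x y : Fin n → ℝ) :
    bilinForm A x y = x ⬝ᵥ ((A : Matrix (Fin n) (Fin n) ℝ) *ᵥ y) :=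
  Matrix.toLinearMap₂'_apply' _ _ _

theorem quadForm_apply (A : Sym n) (x : Fin n → ℝ) : quadForm A x = bilinForm A x x := rfl

theorem mem_COP_iff : A ∈ COP K ↔ ∀ x ∈ K, 0 ≤ quadForm A x := by
  simp only [quadForm_apply, bilinForm_apply]
  rfl

theorem COP_anti : Antitone (COP (n := n)) := fun _ _ hKL _ hA x hx => hA x (hKL hx)

theorem mem_COP_univ_iff : A ∈ COP Set.univ ↔ (A : Matrix (Fin n) (Fin n) ℝ).PosSemidef := by
  rw [Matrix.posSemidef_iff_dotProduct_mulVec]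
  exact ⟨fun h => ⟨A.2, fun x => h x trivial⟩, fun h x _ => h.2 x⟩

theorem mulVec_eq_zero_of_mem_COP_univ (hA : A ∈ COP Set.univ) {x : Fin n → ℝ}
    (hx : quadForm A x = 0) : (A : Matrix (Fin n) (Fin n) ℝ) *ᵥ x = 0 := by
  rw [quadForm_apply, bilinForm_apply] at hx
  exact ((mem_COP_univ_iff.1 hA).dotProduct_mulVec_zero_iff x).1 hx

end QuadForm

section Dyad

variable {n : ℕ} {K : Set (Fin n → ℝ)}

/-- The rank-one matrix `v vᵀ`. -/
def dyad (v : Fin n → ℝ) : Sym n :=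
  ⟨Matrix.vecMulVec v v, Matrix.transpose_vecMulVec v v⟩

theorem dyad_apply (v : Fin n → ℝ) (i j : Fin n) :
    (dyad v : Matrix (Fin n) (Fin n) ℝ) i j = v i * v j := rfl

theorem dyad_zero : dyad (0 : Fin n → ℝ) = 0 := by
  ext i j
  simp [dyad_apply]

theorem dyad_smul (c : ℝ) (v : Fin n → ℝ) : dyad (c • v) = c ^ 2 • dyad v := by
  ext i j
  simp only [dyad_apply, Pi.smul_apply, smul_eq_mul, Submodule.coe_smul, Matrix.smul_apply]
  ring

theorem dyad_add_smul (a b : Fin n → ℝ) (s : ℝ) :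
    dyad (a + s • b) = dyad a + s • (dyad (a + b) - dyad a - dyad b) + s ^ 2 • dyad b := by
  ext i j
  simp only [dyad_apply, Pi.add_apply, Pi.smul_apply, smul_eq_mul, Submodule.coe_smul,
    Submodule.coe_add, Submodule.coe_sub, Matrix.smul_apply, Matrix.add_apply, Matrix.sub_apply]
  ring

theorem dyad_add_add_dyad_sub (u v : Fin n → ℝ) :
    dyad (u + v) + dyad (u - v) = (2 : ℝ) • (dyad u + dyad v) := by
  ext i j
  simp only [dyad_apply, Pi.add_apply, Pi.sub_apply, smul_eq_mul, Submodule.coe_smul,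
    Submodule.coe_add, Matrix.smul_apply, Matrix.add_apply]
  ring

theorem quadForm_dyad (v x : Fin n → ℝ) : quadForm (dyad v) x = (v ⬝ᵥ x) ^ 2 := by
  rw [quadForm_apply, bilinForm_apply, dyad, Matrix.vecMulVec_mulVec, sq]
  simp [dotProduct_comm]

theorem dyad_ne_zero {v : Fin n → ℝ} (hv : v ≠ 0) : dyad v ≠ 0 := by
  intro h
  have hvv := quadForm_dyad v v
  rw [h, map_zero, zero_apply, eq_comm, sq_eq_zero_iff] at hvv
  exact hv (dotProduct_self_eq_zero.1 hvv)

theorem dyad_mem_COP (v : Fin n → ℝ) : dyad v ∈ COP K :=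
  mem_COP_iff.2 fun x _ => quadForm_dyad v x ▸ sq_nonneg _

theorem COP_univ_eq_hull : COP Set.univ = PointedCone.hull ℝ (Set.range (dyad (n := n))) := by
  refine le_antisymm (fun A hA => ?_) (Submodule.span_le.2 ?_)
  · obtain ⟨m, v, hv⟩ := Matrix.posSemidef_iff_eq_sum_vecMulVec.1 (mem_COP_univ_iff.1 hA)
    have hA : A = ∑ i, dyad (v i) := Subtype.ext (by simp [hv, dyad])
    exact hA ▸ sum_mem fun i _ => PointedCone.subset_hull ⟨v i, rfl⟩
  · rintro _ ⟨v, rfl⟩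
    exact dyad_mem_COP v

/-- Moving `dyad (a + s • b)` in the direction `-dyad b` makes the form negative at any `x` with
`(a + s • b) ⬝ᵥ x = 0` and `b ⬝ᵥ x ≠ 0`. -/
theorem not_isPolyhedral_of_dyad_add_smul_mem {C : PointedCone ℝ (Sym n)} (hC : C ≤ COP K)
    {a b : Fin n → ℝ} {S : Set ℝ} (hS : S.Infinite) (hmem : ∀ s ∈ S, dyad (a + s • b) ∈ C)
    (hK : ∀ s ∈ S, ∃ x ∈ K, (a + s • b) ⬝ᵥ x = 0 ∧ b ⬝ᵥ x ≠ 0) : ¬ IsPolyhedral C := by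
  refine not_isPolyhedral_of_parabola (r := dyad b) hS
    (fun s hs => dyad_add_smul a b s ▸ hmem s hs) fun s hs ε hε hmem => ?_
  obtain ⟨x, hxK, hx0, hbx⟩ := hK s hs
  have hneg := mem_COP_iff.1 (hC (dyad_add_smul a b s ▸ hmem)) x hxK
  rw [map_sub, map_smul, sub_apply, smul_apply, quadForm_dyad,
    quadForm_dyad, hx0, smul_eq_mul] at hneg
  have : 0 < ε * (b ⬝ᵥ x) ^ 2 := by positivity
  linarith

end Dyad

section ZeroFace

variable {n : ℕ} {A : Sym n} {K W : Set (Fin n → ℝ)}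

/-- The matrices of `COP K` whose quadratic form vanishes on `W`; for `W ⊆ K` it is a face. -/
def zeroFace (K W : Set (Fin n → ℝ)) : PointedCone ℝ (Sym n) where
  carrier := {A | A ∈ COP K ∧ ∀ w ∈ W, quadForm A w = 0}
  zero_mem' := ⟨zero_mem _, fun w _ => by simp⟩
  add_mem' := fun hA hB => ⟨add_mem hA.1 hB.1, fun w hw => by simp [hA.2 w hw, hB.2 w hw]⟩
  smul_mem' := fun c A hA => ⟨Submodule.smul_mem _ c hA.1, fun w hw => by
    rw [show c • A = (c : ℝ) • A from rfl]
    simp [hA.2 w hw]⟩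

theorem mem_zeroFace_iff : A ∈ zeroFace K W ↔ A ∈ COP K ∧ ∀ w ∈ W, quadForm A w = 0 := Iff.rfl

theorem zeroFace_le_COP : zeroFace K W ≤ COP K := fun _ => And.left

theorem dyad_mem_zeroFace_iff {v : Fin n → ℝ} :
    dyad v ∈ zeroFace K W ↔ ∀ w ∈ W, v ⬝ᵥ w = 0 := by
  simp [mem_zeroFace_iff, dyad_mem_COP, quadForm_dyad]

theorem isFaceOf_zeroFace (hWK : W ⊆ K) : (zeroFace K W).IsFaceOf (COP K) := by
  refine .of_mem_of_add_mem_left zeroFace_le_COP fun {A B} hA hB hAB => ⟨hA, fun w hw => ?_⟩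
  have hsum := hAB.2 w hw
  rw [map_add, add_apply] at hsum
  linarith [mem_COP_iff.1 hA w (hWK hw), mem_COP_iff.1 hB w (hWK hw)]

end ZeroFace

section Lorentz

variable {n : ℕ} [NeZero n] {A : Sym n}

/-- The matrix `diag(1, -1, …, -1)` of the Lorentz form. -/
def lorentz (n : ℕ) [NeZero n] : Sym n :=
  ⟨Matrix.diagonal fun i => if i = 0 then 1 else -1, Matrix.isSymm_diagonal _⟩

theorem quadForm_lorentz (x : Fin n → ℝ) :
    quadForm (lorentz n) x = x 0 ^ 2 - ∑ i ∈ Finset.univ.erase (0 : Fin n), x i ^ 2 := by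
  rw [quadForm_apply, bilinForm_apply, dotProduct,
    ← Finset.add_sum_erase _ _ (Finset.mem_univ (0 : Fin n)), sub_eq_add_neg,
    ← Finset.sum_neg_distrib]
  simp only [lorentz, Matrix.mulVec_diagonal]
  refine congrArg₂ _ (by simp only [if_true]; ring) (Finset.sum_congr rfl fun i hi => ?_)
  rw [if_neg (Finset.ne_of_mem_erase hi)]
  ring

theorem quadForm_lorentz_single_add_smul_single {i : Fin n} (hi : i ≠ 0) (s : ℝ) :
    quadForm (lorentz n) (Pi.single 0 1 + s • Pi.single i 1) = 1 - s ^ 2 := by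
  rw [quadForm_lorentz, Finset.sum_eq_single i]
  · simp [hi, hi.symm]
  · intro j hj hji
    simp [hji, Finset.ne_of_mem_erase hj]
  · simp [hi]

theorem mem_secondOrderCone_iff {x : Fin n → ℝ} :
    x ∈ secondOrderCone n ↔ 0 ≤ x 0 ∧ 0 ≤ quadForm (lorentz n) x := by
  rw [quadForm_lorentz, sub_nonneg]
  exact Real.sqrt_le_iff

theorem lorentz_mem_COP : lorentz n ∈ COP (secondOrderCone n) :=
  mem_COP_iff.2 fun _ hx => (mem_secondOrderCone_iff.1 hx).2

theorem quadForm_nonneg_of_lorentz_nonneg (hA : A ∈ COP (secondOrderCone n)) {x : Fin n → ℝ}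
    (hx : 0 ≤ quadForm (lorentz n) x) : 0 ≤ quadForm A x := by
  rcases le_total 0 (x 0) with h0 | h0
  · exact mem_COP_iff.1 hA x (mem_secondOrderCone_iff.2 ⟨h0, hx⟩)
  · rw [← QuadraticMap.map_neg] at hx ⊢
    exact mem_COP_iff.1 hA (-x) (mem_secondOrderCone_iff.2 ⟨neg_nonneg.2 h0, hx⟩)

theorem mem_COP_secondOrderCone_iff :
    A ∈ COP (secondOrderCone n) ↔ ∃ P ∈ COP Set.univ, ∃ t ≥ (0 : ℝ), P + t • lorentz n = A := by
  constructor
  · intro hA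
    have hslater : ∃ x, 0 < quadForm (lorentz n) x := ⟨Pi.single 0 1, by
      rw [quadForm_lorentz, Finset.sum_eq_zero] <;> simp +contextual⟩
    obtain ⟨t, ht, hle⟩ :=
      exists_mul_le_of_nonneg_imp (fun x => quadForm_nonneg_of_lorentz_nonneg hA) hslater
    refine ⟨A - t • lorentz n, mem_COP_iff.2 fun x _ => ?_, t, ht, sub_add_cancel _ _⟩
    rw [map_sub, map_smul, sub_apply, smul_apply, smul_eq_mul]
    exact sub_nonneg.2 (hle x)
  · rintro ⟨P, hP, t, ht, rfl⟩
    exact add_mem (COP_anti (Set.subset_univ _) hP)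
      (PointedCone.smul_mem _ ht lorentz_mem_COP)

theorem COP_secondOrderCone_eq_hull :
    COP (secondOrderCone n) = PointedCone.hull ℝ (insert (lorentz n) (Set.range dyad)) := by
  refine le_antisymm (fun A hA => ?_) (Submodule.span_le.2 ?_)
  · obtain ⟨P, hP, t, ht, rfl⟩ := mem_COP_secondOrderCone_iff.1 hA
    rw [COP_univ_eq_hull] at hP
    exact add_mem (Submodule.span_mono (Set.subset_insert _ _) hP)
      (PointedCone.smul_mem _ ht (PointedCone.subset_hull (Set.mem_insert _ _)))
  · rintro _ (rfl | ⟨v, rfl⟩)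
    exacts [lorentz_mem_COP, dyad_mem_COP v]

theorem smul_dyad_ne_lorentz [Nontrivial (Fin n)] (c : ℝ) (v : Fin n → ℝ) :
    c • dyad v ≠ lorentz n := by
  intro h
  obtain ⟨i, hi⟩ := exists_ne (0 : Fin n)
  have hentry (j : Fin n) : c * (v j * v j) = if j = 0 then 1 else -1 := by
    simpa [dyad_apply, lorentz] using
      congrArg (fun M : Sym n => (M : Matrix (Fin n) (Fin n) ℝ) j j) h
  have h0 := hentry 0
  have hi' := hentry i
  rw [if_pos rfl] at h0
  rw [if_neg hi] at hi'
  have hsq : (c * v 0 * v i) ^ 2 = -1 := by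
    linear_combination c * (v i * v i) * h0 + hi'
  linarith [sq_nonneg (c * v 0 * v i)]

theorem linearIndepOn_dyad_lorentz [Nontrivial (Fin n)] {v : Fin n → ℝ} (hv : v ≠ 0) :
    LinearIndepOn ℝ id {dyad v, lorentz n} := by
  have hne : dyad v ≠ lorentz n := by simpa only [one_smul] using smul_dyad_ne_lorentz 1 v
  exact (linearIndepOn_pair_iff id hne (dyad_ne_zero hv)).2 fun c => smul_dyad_ne_lorentz c v

end Lorentz

section FaceRank

variable {n : ℕ} {K : Set (Fin n → ℝ)} {F G : PointedCone ℝ (Sym n)}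

/-- The span of the vectors `v` with `v vᵀ ∈ F`. If `F` is a face of a copositive cone, then these
vectors already form a subspace. -/
def dyadSpace (F : PointedCone ℝ (Sym n)) : Submodule ℝ (Fin n → ℝ) :=
  Submodule.span ℝ {v | dyad v ∈ F}

theorem dyadSpace_mono : Monotone (dyadSpace (n := n)) :=
  fun _ _ hFG => Submodule.span_mono fun _ hv => hFG hv

theorem mem_dyadSpace_iff (hF : F.IsFaceOf (COP K)) {v : Fin n → ℝ} :
    v ∈ dyadSpace F ↔ dyad v ∈ F := by
  refine ⟨fun hv => ?_, fun hv => Submodule.subset_span hv⟩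
  induction hv using Submodule.span_induction with
  | mem _ hv => exact hv
  | zero => exact dyad_zero ▸ zero_mem F
  | add u v _ _ hu hv =>
    refine hF.mem_of_add_mem_left (dyad_mem_COP _) (dyad_mem_COP (u - v)) ?_
    rw [dyad_add_add_dyad_sub]
    exact F.smul_mem zero_le_two (add_mem hu hv)
  | smul c v _ hv => exact dyad_smul c v ▸ F.smul_mem (sq_nonneg c) hv

variable [NeZero n]

theorem hull_lorentz_dyad_inter_eq (hF : F.IsFaceOf (COP (secondOrderCone n))) :
    PointedCone.hull ℝ (insert (lorentz n) (Set.range dyad) ∩ F) = F := by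
  rw [COP_secondOrderCone_eq_hull] at hF
  exact hull_inter_eq_of_isFaceOf hF

theorem le_of_dyadSpace_le (hF : F.IsFaceOf (COP (secondOrderCone n)))
    (hG : G.IsFaceOf (COP (secondOrderCone n))) (hspace : dyadSpace F ≤ dyadSpace G)
    (hlorentz : lorentz n ∈ F → lorentz n ∈ G) : F ≤ G := by
  rw [← hull_lorentz_dyad_inter_eq hF, Submodule.span_le]
  rintro _ ⟨rfl | ⟨v, rfl⟩, hv⟩
  · exact hlorentz hv
  · exact (mem_dyadSpace_iff hG).1 (hspace ((mem_dyadSpace_iff hF).2 hv))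

open Classical in
/-- The number of dimensions that a face of `COP (secondOrderCone n)` takes up in the space of
vectors `v` (with extreme rays `v vᵀ`) and along the ray of the Lorentz form. -/
def faceRank (F : PointedCone ℝ (Sym n)) : ℕ :=
  Module.finrank ℝ (dyadSpace F) + if lorentz n ∈ F then 1 else 0

theorem faceRank_le (F : PointedCone ℝ (Sym n)) : faceRank F ≤ n + 1 := by
  have h := Submodule.finrank_le (dyadSpace F)
  rw [Module.finrank_fin_fun] at h
  rw [faceRank]
  split_ifs <;> omega

theorem faceRank_strictMonoOn :
    StrictMonoOn (faceRank (n := n)) {F | F.IsFaceOf (COP (secondOrderCone n))} := by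
  intro F hF G hG hFG
  by_contra! hle
  have hspace := dyadSpace_mono hFG.le
  have hfinrank := Submodule.finrank_mono hspace
  have hlorentz : lorentz n ∈ F → lorentz n ∈ G := fun h => hFG.le h
  refine hFG.not_ge (le_of_dyadSpace_le hG hF ?_ ?_)
  · refine (Submodule.eq_of_le_of_finrank_le hspace ?_).ge
    rw [faceRank, faceRank] at hle
    split_ifs at hle <;> grind
  · intro hGJ
    by_contra hFJ
    rw [faceRank, faceRank, if_pos hGJ, if_neg hFJ] at hle
    omega

theorem exists_le_span_singleton_of_finrank_le_one {k V : Type*} [DivisionRing k]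
    [AddCommGroup V] [Module k V] [Nontrivial V] [FiniteDimensional k V] {W : Submodule k V}
    (hW : Module.finrank k W ≤ 1) : ∃ v ≠ 0, W ≤ Submodule.span k {v} := by
  obtain ⟨v, rfl⟩ := (W.finrank_le_one_iff_isPrincipal.1 hW).principal
  rcases eq_or_ne v 0 with rfl | hv
  · obtain ⟨u, hu⟩ := exists_ne (0 : V)
    exact ⟨u, hu, by simp⟩
  · exact ⟨v, hv, le_rfl⟩

theorem isPolyhedral_of_finrank_dyadSpace_le_one [Nontrivial (Fin n)]
    (hF : F.IsFaceOf (COP (secondOrderCone n))) (hdim : Module.finrank ℝ (dyadSpace F) ≤ 1) :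
    IsPolyhedral F := by
  obtain ⟨v, hv0, hv⟩ := exists_le_span_singleton_of_finrank_le_one hdim
  suffices hgen : F = PointedCone.hull ℝ ({dyad v, lorentz n} ∩ F) by
    rw [hgen]
    exact isPolyhedral_hull_of_linearIndepOn
      ((linearIndepOn_dyad_lorentz hv0).mono Set.inter_subset_left)
  refine le_antisymm ?_ (Submodule.span_le.2 Set.inter_subset_right)
  refine (hull_lorentz_dyad_inter_eq hF).ge.trans (Submodule.span_le.2 ?_)
  rintro _ ⟨rfl | ⟨w, rfl⟩, hmem⟩
  · exact PointedCone.subset_hull ⟨Or.inr rfl, hmem⟩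
  · obtain ⟨c, rfl⟩ := Submodule.mem_span_singleton.1 (hv ((mem_dyadSpace_iff hF).2 hmem))
    rw [dyad_smul] at hmem ⊢
    rcases eq_or_ne c 0 with rfl | hc
    · simp
    · have hvF : dyad v ∈ F := (PointedCone.smul_mem_iff F (by positivity)).1 hmem
      exact PointedCone.smul_mem _ (sq_nonneg c) (PointedCone.subset_hull ⟨Or.inl rfl, hvF⟩)

theorem two_le_faceRank [Nontrivial (Fin n)] (hF : F.IsFaceOf (COP (secondOrderCone n)))
    (hpoly : ¬ IsPolyhedral F) : 2 ≤ faceRank F := by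
  have hdim := mt (isPolyhedral_of_finrank_dyadSpace_le_one hF) hpoly
  rw [faceRank]
  omega

theorem lorentz_mem_of_dyadSpace_eq_top (hF : F.IsFaceOf (COP (secondOrderCone n)))
    (htop : dyadSpace F = ⊤) : lorentz n ∈ F := by
  have hle : COP Set.univ ≤ F := by
    rw [COP_univ_eq_hull]
    refine Submodule.span_le.2 ?_
    rintro _ ⟨v, rfl⟩
    exact (mem_dyadSpace_iff hF).1 (htop ▸ Submodule.mem_top)
  let D : Sym n := ⟨Matrix.diagonal fun i => if i = 0 then 0 else 2, Matrix.isSymm_diagonal _⟩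
  have hD : D ∈ COP Set.univ :=
    mem_COP_univ_iff.2 (Matrix.PosSemidef.diagonal fun i => by dsimp; split_ifs <;> norm_num)
  have hid : ((lorentz n + D : Sym n) : Matrix (Fin n) (Fin n) ℝ) = 1 := by
    rw [Submodule.coe_add, lorentz, Matrix.diagonal_add, ← Matrix.diagonal_one]
    refine congrArg _ (funext fun i => ?_)
    split_ifs <;> norm_num
  have hsum : lorentz n + D ∈ COP Set.univ := mem_COP_univ_iff.2 (hid ▸ .one)
  exact hF.mem_of_add_mem_left lorentz_mem_COP (COP_anti (Set.subset_univ _) hD) (hle hsum)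

end FaceRank

section LowerBound

theorem exists_dotProduct_eq_zero_of_notMem {k ι : Type*} [Field k] [Fintype ι]
    {W : Submodule k (ι → k)} {w : ι → k} (hw : w ∉ W) :
    ∃ v, (∀ x ∈ W, v ⬝ᵥ x = 0) ∧ v ⬝ᵥ w ≠ 0 := by
  classical
  obtain ⟨φ, hφw, hφ⟩ := Submodule.exists_le_ker_of_notMem hw
  obtain ⟨v, rfl⟩ := (dotProductEquiv k ι).surjective φ
  exact ⟨v, fun x hx => hφ hx, hφw⟩

variable {n : ℕ} {K : Set (Fin n → ℝ)}

theorem zeroFace_antitone : Antitone (zeroFace K) :=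
  fun _ _ hW _ hA => ⟨hA.1, fun w hw => hA.2 w (hW hw)⟩

theorem zeroFace_univ_span (S : Set (Fin n → ℝ)) :
    zeroFace Set.univ (Submodule.span ℝ S) = zeroFace Set.univ S := by
  refine le_antisymm (zeroFace_antitone Submodule.subset_span) fun A hA => ⟨hA.1, fun w hw => ?_⟩
  have hker : Submodule.span ℝ S ≤
      LinearMap.ker (A : Matrix (Fin n) (Fin n) ℝ).mulVecLin :=
    Submodule.span_le.2 fun s hs => mulVec_eq_zero_of_mem_COP_univ hA.1 (hA.2 s hs)
  have hAw : (A : Matrix (Fin n) (Fin n) ℝ) *ᵥ w = 0 := hker hw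
  rw [quadForm_apply, bilinForm_apply, hAw, dotProduct_zero]

theorem zeroFace_univ_strictAnti :
    StrictAnti fun W : Submodule ℝ (Fin n → ℝ) => zeroFace Set.univ (W : Set (Fin n → ℝ)) := by
  intro W W' hW
  refine (zeroFace_antitone hW.le).lt_of_not_ge fun hle => ?_
  obtain ⟨w, hwW', hwW⟩ := SetLike.exists_of_lt hW
  obtain ⟨v, hv, hvw⟩ := exists_dotProduct_eq_zero_of_notMem hwW
  exact hvw (dyad_mem_zeroFace_iff.1 (hle (dyad_mem_zeroFace_iff.2 hv)) w hwW')

theorem exists_notMem_of_finrank_lt {k V : Type*} [Semiring k] [AddCommMonoid V]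
    [Module k V] {W : Submodule k V} (hW : Module.finrank k W < Module.finrank k V) :
    ∃ v, v ∉ W :=
  SetLike.exists_not_mem_of_ne_top W fun h => by
    rw [h, finrank_top] at hW
    exact hW.false

theorem not_isPolyhedral_zeroFace_univ {W : Submodule ℝ (Fin n → ℝ)}
    (hW : Module.finrank ℝ W + 2 ≤ n) :
    ¬ IsPolyhedral (zeroFace Set.univ (W : Set (Fin n → ℝ))) := by
  obtain ⟨y, hy⟩ : ∃ y, y ∉ W :=
    exists_notMem_of_finrank_lt (by rw [Module.finrank_fin_fun]; omega)
  obtain ⟨z, hz⟩ : ∃ z, z ∉ W ⊔ Submodule.span ℝ {y} := exists_notMem_of_finrank_lt (by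
    rw [Submodule.finrank_sup_span_singleton hy, Module.finrank_fin_fun]; omega)
  obtain ⟨a, haW, hay⟩ := exists_dotProduct_eq_zero_of_notMem hy
  obtain ⟨b, hb, hbz⟩ := exists_dotProduct_eq_zero_of_notMem hz
  have hbW (w) (hw : w ∈ W) : b ⬝ᵥ w = 0 := hb w (Submodule.mem_sup_left hw)
  have hby : b ⬝ᵥ y = 0 :=
    hb y (Submodule.mem_sup_right (Submodule.mem_span_singleton_self y))
  refine not_isPolyhedral_of_dyad_add_smul_mem zeroFace_le_COP (a := a) (b := b) Set.infinite_univ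
    (fun s _ => dyad_mem_zeroFace_iff.2 fun w hw => ?_)
    fun s _ => ⟨z - ((a ⬝ᵥ z + s * (b ⬝ᵥ z)) / (a ⬝ᵥ y)) • y, trivial, ?_, ?_⟩
  · rw [add_dotProduct, smul_dotProduct, haW w hw, hbW w hw, smul_zero, add_zero]
  · simp only [add_dotProduct, smul_dotProduct, dotProduct_sub, dotProduct_smul, smul_eq_mul, hby]
    field_simp
    ring
  · rwa [dotProduct_sub, dotProduct_smul, hby, smul_zero, sub_zero]

theorem add_one_le_distToPolyhedrality_zeroFace_univ {k : ℕ} {W : Submodule ℝ (Fin n → ℝ)}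
    (hW : Module.finrank ℝ W + k + 2 ≤ n) :
    (k + 1 : ℕ∞) ≤ distToPolyhedrality (zeroFace Set.univ (W : Set (Fin n → ℝ))) := by
  induction k generalizing W with
  | zero => simpa using one_le_distToPolyhedrality (not_isPolyhedral_zeroFace_univ hW)
  | succ k ih =>
    obtain ⟨y, hy⟩ : ∃ y, y ∉ W :=
      exists_notMem_of_finrank_lt (by rw [Module.finrank_fin_fun]; omega)
    have hlt : W < W ⊔ Submodule.span ℝ {y} := by simpa [left_lt_sup] using hy
    have hk := ih (W := W ⊔ Submodule.span ℝ {y}) (by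
      rw [Submodule.finrank_sup_span_singleton hy]; omega)
    have hface := ((isFaceOf_zeroFace (Set.subset_univ _)).isFaceOf_iff_le
      (isFaceOf_zeroFace (Set.subset_univ _))).2 (zeroFace_univ_strictAnti hlt).le
    push_cast
    exact (add_le_add_left hk 1).trans (distToPolyhedrality_add_one_le hface
      (zeroFace_univ_strictAnti hlt).ne (le_add_self.trans hk))

variable [NeZero n] {u : Fin n → ℝ}

theorem exists_lorentz_null [Nontrivial (Fin n)] : ∃ u, 0 < u 0 ∧ quadForm (lorentz n) u = 0 := by
  obtain ⟨i, hi⟩ := exists_ne (0 : Fin n)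
  refine ⟨Pi.single 0 1 + (1 : ℝ) • Pi.single i 1, by simp [hi.symm], ?_⟩
  rw [quadForm_lorentz_single_add_smul_single hi]
  norm_num

theorem lorentz_notMem_COP_univ [Nontrivial (Fin n)] : lorentz n ∉ COP Set.univ := by
  intro h
  obtain ⟨i, hi⟩ := exists_ne (0 : Fin n)
  have hneg := mem_COP_iff.1 h (Pi.single 0 1 + (2 : ℝ) • Pi.single i 1) trivial
  rw [quadForm_lorentz_single_add_smul_single hi] at hneg
  norm_num at hneg

theorem exists_add_smul_lorentz_of_mem_zeroFace (hu : quadForm (lorentz n) u = 0) {A : Sym n}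
    (hA : A ∈ zeroFace (secondOrderCone n) {u}) :
    ∃ P ∈ zeroFace Set.univ {u}, ∃ t ≥ (0 : ℝ), P + t • lorentz n = A := by
  obtain ⟨P, hP, t, ht, rfl⟩ := mem_COP_secondOrderCone_iff.1 hA.1
  refine ⟨P, ⟨hP, fun w hw => ?_⟩, t, ht, rfl⟩
  have hw0 := hA.2 w hw
  rw [Set.mem_singleton_iff.1 hw] at hw0 ⊢
  simpa [hu] using hw0

/-- On `zeroFace (secondOrderCone n) {u}`, the matrices `P + t • lorentz n` with `P u = 0`, the
functional `A ↦ (A u)₀ = t u₀` detects the coefficient `t`. -/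
theorem isFaceOf_zeroFace_univ_singleton (hu0 : 0 < u 0) (hu : quadForm (lorentz n) u = 0) :
    (zeroFace Set.univ {u}).IsFaceOf (zeroFace (secondOrderCone n) {u}) := by
  let τ : Sym n →ₗ[ℝ] ℝ :=
    LinearMap.applyₗ u ∘ₗ LinearMap.applyₗ (Pi.single 0 1) ∘ₗ bilinForm
  have hτ_psd (P) (hP : P ∈ zeroFace Set.univ {u}) : τ P = 0 := by
    change bilinForm P _ u = 0
    rw [bilinForm_apply, mulVec_eq_zero_of_mem_COP_univ hP.1 (hP.2 u rfl), dotProduct_zero]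
  have hτ_lorentz : τ (lorentz n) = u 0 := by
    change bilinForm _ _ u = u 0
    rw [bilinForm_apply]
    simp [lorentz, Matrix.mulVec_diagonal]
  have hτ (P) (hP : P ∈ zeroFace Set.univ {u}) (t : ℝ) : τ (P + t • lorentz n) = t * u 0 := by
    rw [map_add, map_smul, hτ_psd P hP, hτ_lorentz, zero_add, smul_eq_mul]
  have hker : zeroFace Set.univ {u} =
      zeroFace (secondOrderCone n) {u} ⊓ PointedCone.ofSubmodule (LinearMap.ker τ) := by
    refine le_antisymm
      (fun P hP => ⟨⟨COP_anti (Set.subset_univ _) hP.1, hP.2⟩, hτ_psd P hP⟩) ?_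
    rintro A ⟨hA, hτA⟩
    obtain ⟨P, hP, t, -, rfl⟩ := exists_add_smul_lorentz_of_mem_zeroFace hu hA
    have ht : t * u 0 = 0 := (hτ P hP t).symm.trans hτA
    rw [(mul_eq_zero_iff_right hu0.ne').1 ht, zero_smul, add_zero]
    exact hP
  rw [hker]
  refine isFaceOf_inf_ker fun A hA => ?_
  obtain ⟨P, hP, t, ht, rfl⟩ := exists_add_smul_lorentz_of_mem_zeroFace hu hA
  exact hτ P hP t ▸ mul_nonneg ht hu0.le

end LowerBound

section DistToPolyhedrality

variable {n : ℕ} [NeZero n]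

theorem not_isPolyhedral_COP_secondOrderCone [Nontrivial (Fin n)] :
    ¬ IsPolyhedral (COP (secondOrderCone n)) := by
  obtain ⟨i, hi⟩ := exists_ne (0 : Fin n)
  refine not_isPolyhedral_of_dyad_add_smul_mem le_rfl (a := -Pi.single i 1) (b := Pi.single 0 1)
    (Set.Icc_infinite zero_lt_one) (fun s _ => dyad_mem_COP _) fun s hs =>
      ⟨Pi.single 0 1 + s • Pi.single i 1, mem_secondOrderCone_iff.2 ⟨by simp [hi.symm], ?_⟩, ?_, ?_⟩
  · rw [quadForm_lorentz_single_add_smul_single hi]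
    nlinarith [hs.1, hs.2]
  · simp [hi, hi.symm]
  · simp [hi.symm]

theorem distToPolyhedrality_COP_secondOrderCone_le [Nontrivial (Fin n)] :
    distToPolyhedrality (COP (secondOrderCone n)) ≤ n :=
  distToPolyhedrality_le_of_strictMonoOn faceRank_strictMonoOn (fun F _ => faceRank_le F)
    fun _ => two_le_faceRank

theorem le_distToPolyhedrality_COP_secondOrderCone (hn : 3 ≤ n) :
    n ≤ distToPolyhedrality (COP (secondOrderCone n)) := by
  have : Nontrivial (Fin n) := Fin.nontrivial_iff_two_le.2 (by omega)
  obtain ⟨k, rfl⟩ := Nat.exists_eq_add_of_le' hn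
  obtain ⟨u, hu0, hu⟩ := exists_lorentz_null (n := k + 3)
  have hune : u ≠ 0 := fun h => hu0.ne' (congrFun h 0)
  have hpsd : (k + 1 : ℕ∞) ≤ distToPolyhedrality (zeroFace Set.univ {u}) := by
    rw [← zeroFace_univ_span]
    exact add_one_le_distToPolyhedrality_zeroFace_univ
      (by rw [finrank_span_singleton hune]; omega)
  have hpsd_ne : zeroFace Set.univ {u} ≠ zeroFace (secondOrderCone (k + 3)) {u} := fun h =>
    lorentz_notMem_COP_univ (h.ge ⟨lorentz_mem_COP, by simpa using hu⟩).1
  have hnull_ne : zeroFace (secondOrderCone (k + 3)) {u} ≠ COP (secondOrderCone (k + 3)) :=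
    fun h => hune (dotProduct_self_eq_zero.1
      (dyad_mem_zeroFace_iff.1 (h.ge (dyad_mem_COP u)) u rfl))
  have hnull : (k + 1 + 1 : ℕ∞) ≤ distToPolyhedrality (zeroFace (secondOrderCone (k + 3)) {u}) :=
    (add_le_add_left hpsd 1).trans (distToPolyhedrality_add_one_le
      (isFaceOf_zeroFace_univ_singleton hu0 hu) hpsd_ne (le_add_self.trans hpsd))
  have hu_mem : {u} ⊆ secondOrderCone (k + 3) :=
    Set.singleton_subset_iff.2 (mem_secondOrderCone_iff.2 ⟨hu0.le, hu.ge⟩)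
  exact (add_le_add_left hnull 1).trans (distToPolyhedrality_add_one_le
    (isFaceOf_zeroFace hu_mem) hnull_ne (le_add_self.trans hnull))

theorem distToPolyhedrality_COP_secondOrderCone_two_le :
    distToPolyhedrality (COP (secondOrderCone 2)) ≤ 1 := by
  refine distToPolyhedrality_le_of_strictMonoOn (a := 3) faceRank_strictMonoOn
    (fun F _ => faceRank_le F) fun F hF hpoly => ?_
  have hdim := mt (isPolyhedral_of_finrank_dyadSpace_le_one hF) hpoly
  have htop : dyadSpace F = ⊤ := Submodule.eq_top_of_finrank_eq <|
    le_antisymm (Submodule.finrank_le _) (by rw [Module.finrank_fin_fun]; omega)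
  rw [faceRank, htop, finrank_top, Module.finrank_fin_fun,
    if_pos (lorentz_mem_of_dyadSpace_eq_top hF htop)]

end DistToPolyhedrality

end CopositiveSOC

end

theorem mainTheorem6 (n : ℕ) [NeZero n] :
    (n = 2 → CopositiveSOC.distToPolyhedrality
      (CopositiveSOC.COP (CopositiveSOC.secondOrderCone n)) = 1) ∧
    (3 ≤ n → CopositiveSOC.distToPolyhedrality
      (CopositiveSOC.COP (CopositiveSOC.secondOrderCone n)) = (n : ℕ∞)) := by
  constructor
  · rintro rfl
    exact le_antisymm CopositiveSOC.distToPolyhedrality_COP_secondOrderCone_two_le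
      (CopositiveSOC.one_le_distToPolyhedrality CopositiveSOC.not_isPolyhedral_COP_secondOrderCone)
  · intro hn
    have : Nontrivial (Fin n) := Fin.nontrivial_iff_two_le.2 (by omega)
    exact le_antisymm CopositiveSOC.distToPolyhedrality_COP_secondOrderCone_le
      (CopositiveSOC.le_distToPolyhedrality_COP_secondOrderCone hn)
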